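/- A three-qubit density matrix $\varrho$ is a \emph{triangle network state} if $$\varrho=\sum_\lambda p_\lambda\,\mathcal E_A^{(\lambda)}\otimes\mathcal E_B^{(\lambda)}\otimes\mathcal E_C^{(\lambda)}[\varrho_a\otimes\varrho_b\otimes\varrho_c],$$ where $\varrho_a,\varrho_b,\varrho_c$ are bipartite states of arbitrary finite dimension shared by Bob and Charlie, Alice and Charlie, and Alice and Bob, respectively; $(p_\lambda)$ is a probability distribution; and $\mathcal E_A^{(\lambda)},\mathcal E_B^{(\lambda)},\mathcal E_C^{(\lambda)}$ are quantum channels (completely positive trace-preserving maps), each acting on the two subsystems held by one party and with output one qubit. Let $|GHZ\rangle=(|000\rangle+|111\rangle)/\sqrt2$. Then every triangle network state satisfies $$\langle GHZ|\varrho|GHZ\rangle\le \frac1{\sqrt2}.$$ Moreover, let $F\in[0,1]$, let $\tilde\varrho$ be any three-qubit density matrix, and put $\varrho(F)=F|GHZ\rangle\langle GHZ|+(1-F)\tilde\varrho$. For $i,j\in\{A,B,C\}$ let $E_i=\langle Z_i\rangle$ and $E_{ij}=\langle Z_iZ_j\rangle$ be the expectation values in $\varrho(F)$ of the Pauli-$Z$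 observables of the three qubits, let $\Gamma=(E_{ij}-E_iE_j)_{i,j}$ be their $3\times3$ covariance matrix, and let $M(\Gamma)$ be the matrix obtained from $\Gamma$ by flipping the signs of the off-diagonal entries. (a) If $$(1+|E_A|+|E_B|+E_{AB})^2+(1+|E_A|+|E_C|+E_{AC})^2+(1+|E_B|+|E_C|+E_{BC})^2\le 6(1+|E_A|)(1+|E_B|)(1+|E_C|),$$ then $F\le 1/\sqrt2$. (b) If $M(\Gamma)$ is positive semidefinite, then $F\le 3/4$. -/

import Mathlib

open Matrix
open scoped ComplexOrder Kronecker

namespace TriangleNet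

/-- `ρ` is a density matrix: positive semidefinite with unit trace. -/
def IsState {n : Type*} [Fintype n] (ρ : Matrix n n ℂ) : Prop :=
  ρ.PosSemidef ∧ ρ.trace = 1

/-- The map `id ⊗ E` on matrices over the enlarged system `κ × n`: `E` is applied to each of the
`n × n` blocks. -/
def ampliation {n m : Type*} (κ : Type*) (E : Matrix n n ℂ →ₗ[ℂ] Matrix m m ℂ)
    (M : Matrix (κ × n) (κ × n) ℂ) : Matrix (κ × m) (κ × m) ℂ :=
  Matrix.of fun x y => E (Matrix.of fun i j => M (x.1, i) (y.1, j)) x.2 y.2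

/-- A quantum channel between finite-dimensional systems: a linear map on matrices that is
completely positive and trace preserving. -/
structure IsChannel {n m : Type*} [Fintype n] [Fintype m]
    (E : Matrix n n ℂ →ₗ[ℂ] Matrix m m ℂ) : Prop where
  completelyPositive : ∀ (κ : Type) [Fintype κ] (M : Matrix (κ × n) (κ × n) ℂ),
    M.PosSemidef → (ampliation κ E M).PosSemidef
  tracePreserving : ∀ M : Matrix n n ℂ, (E M).trace = M.trace

/-- The tensor product `E ⊗ F ⊗ G` of three linear maps on matrices: the linear map whose value
on a product of matrix units is `E |i⟩⟨i'| ⊗ F |j⟩⟨j'| ⊗ G |k⟩⟨k'|`. -/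
def tensorMap {n₁ n₂ n₃ m₁ m₂ m₃ : Type*}
    [Fintype n₁] [Fintype n₂] [Fintype n₃] [DecidableEq n₁] [DecidableEq n₂] [DecidableEq n₃]
    (E : Matrix n₁ n₁ ℂ →ₗ[ℂ] Matrix m₁ m₁ ℂ) (F : Matrix n₂ n₂ ℂ →ₗ[ℂ] Matrix m₂ m₂ ℂ)
    (G : Matrix n₃ n₃ ℂ →ₗ[ℂ] Matrix m₃ m₃ ℂ)
    (M : Matrix (n₁ × n₂ × n₃) (n₁ × n₂ × n₃) ℂ) :
    Matrix (m₁ × m₂ × m₃) (m₁ × m₂ × m₃) ℂ :=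
  ∑ i, ∑ i', ∑ j, ∑ j', ∑ k, ∑ k', M (i, j, k) (i', j', k') •
    (E (Matrix.single i i' 1) ⊗ₖ (F (Matrix.single j j' 1) ⊗ₖ G (Matrix.single k k' 1)))

/-- The joint state of the three sources, with the six subsystems regrouped by party.
Source `ρa` is shared by Bob and Charlie, `ρb` by Alice and Charlie, `ρc` by Alice and Bob.
Alice holds her parts of `c` and `b`, Bob of `a` and `c`, Charlie of `b` and `a`. -/
def sourceState {aB aC bA bC cA cB : Type*}
    (ρa : Matrix (aB × aC) (aB × aC) ℂ) (ρb : Matrix (bA × bC) (bA × bC) ℂ)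
    (ρc : Matrix (cA × cB) (cA × cB) ℂ) :
    Matrix ((cA × bA) × (aB × cB) × (bC × aC)) ((cA × bA) × (aB × cB) × (bC × aC)) ℂ :=
  Matrix.of fun x y =>
    ρa (x.2.1.1, x.2.2.2) (y.2.1.1, y.2.2.2) * ρb (x.1.2, x.2.2.1) (y.1.2, y.2.2.1) *
      ρc (x.1.1, x.2.1.2) (y.1.1, y.2.1.2)

/-- Index set of the computational basis of three qubits. -/
abbrev Qubits3 : Type := Fin 2 × Fin 2 × Fin 2

/-- `ρ` is a three-qubit triangle network state:
`ρ = ∑_l p_l (E_A^l ⊗ E_B^l ⊗ E_C^l)[ρ_ABC]`, with three bipartite sources of arbitrary finite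
dimensions, shared randomness `l` with distribution `p`, and local channels depending on `l`. -/
def IsTriangleState (ρ : Matrix Qubits3 Qubits3 ℂ) : Prop :=
  ∃ (aB aC bA bC cA cB : ℕ)
    (ρa : Matrix (Fin aB × Fin aC) (Fin aB × Fin aC) ℂ)
    (ρb : Matrix (Fin bA × Fin bC) (Fin bA × Fin bC) ℂ)
    (ρc : Matrix (Fin cA × Fin cB) (Fin cA × Fin cB) ℂ)
    (L : Type) (p : L → ℝ)
    (EA : L → Matrix (Fin cA × Fin bA) (Fin cA × Fin bA) ℂ →ₗ[ℂ] Matrix (Fin 2) (Fin 2) ℂ)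
    (EB : L → Matrix (Fin aB × Fin cB) (Fin aB × Fin cB) ℂ →ₗ[ℂ] Matrix (Fin 2) (Fin 2) ℂ)
    (EC : L → Matrix (Fin bC × Fin aC) (Fin bC × Fin aC) ℂ →ₗ[ℂ] Matrix (Fin 2) (Fin 2) ℂ),
    IsState ρa ∧ IsState ρb ∧ IsState ρc ∧
    (∀ l, 0 ≤ p l) ∧ HasSum p 1 ∧
    (∀ l, IsChannel (EA l) ∧ IsChannel (EB l) ∧ IsChannel (EC l)) ∧
    HasSum (fun l => (p l : ℂ) • tensorMap (EA l) (EB l) (EC l) (sourceState ρa ρb ρc)) ρ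

/-- The vector `|GHZ⟩ = (|000⟩ + |111⟩) / √2`. -/
noncomputable def ghz : Qubits3 → ℂ :=
  ((1 / Real.sqrt 2 : ℝ) : ℂ) • (Pi.single (0, 0, 0) 1 + Pi.single (1, 1, 1) 1)

/-- The GHZ fidelity `⟨GHZ| ρ |GHZ⟩`, a real number for Hermitian `ρ`. -/
noncomputable def ghzFidelity (ρ : Matrix Qubits3 Qubits3 ℂ) : ℝ :=
  (star ghz ⬝ᵥ ρ *ᵥ ghz).re

/-- The state `F |GHZ⟩⟨GHZ| + (1 - F) σ`. -/
noncomputable def ghzMix (F : ℝ) (σ : Matrix Qubits3 Qubits3 ℂ) : Matrix Qubits3 Qubits3 ℂ :=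
  (F : ℂ) • Matrix.vecMulVec ghz (star ghz) + ((1 - F : ℝ) : ℂ) • σ

/-- The expectation value `Tr(ρ O)` of an observable `O`. -/
noncomputable def expect (ρ O : Matrix Qubits3 Qubits3 ℂ) : ℝ := (ρ * O).trace.re

/-- The Pauli matrix `Z`. -/
def pauliZ : Matrix (Fin 2) (Fin 2) ℂ := !![1, 0; 0, -1]

/-- The observables `Z11`, `1Z1`, `11Z` (party `0` is Alice, `1` is Bob, `2` is Charlie). -/
def zObs : Fin 3 → Matrix Qubits3 Qubits3 ℂ :=
  ![pauliZ ⊗ₖ (1 ⊗ₖ 1), 1 ⊗ₖ (pauliZ ⊗ₖ 1), 1 ⊗ₖ (1 ⊗ₖ pauliZ)]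

/-- One-body expectation values of `Z`. -/
noncomputable def E₁ (ρ : Matrix Qubits3 Qubits3 ℂ) (i : Fin 3) : ℝ := expect ρ (zObs i)

/-- Two-body expectation values of `Z`. -/
noncomputable def E₂ (ρ : Matrix Qubits3 Qubits3 ℂ) (i j : Fin 3) : ℝ :=
  expect ρ (zObs i * zObs j)

/-- The covariance matrix of the outcomes of the three local `Z` measurements. -/
noncomputable def covMatrix (ρ : Matrix Qubits3 Qubits3 ℂ) : Matrix (Fin 3) (Fin 3) ℝ :=
  Matrix.of fun i j => E₂ ρ i j - E₁ ρ i * E₁ ρ j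

/-- The comparison matrix: the signs of the off-diagonal entries are flipped. -/
def comparisonMatrix (Γ : Matrix (Fin 3) (Fin 3) ℝ) : Matrix (Fin 3) (Fin 3) ℝ :=
  Matrix.of fun i j => if i = j then Γ i j else -Γ i j

/-- The network inequality of Gisin et al. for the `Z` correlations of `ρ`. -/
def GisinInequality (ρ : Matrix Qubits3 Qubits3 ℂ) : Prop :=
  (1 + |E₁ ρ 0| + |E₁ ρ 1| + E₂ ρ 0 1) ^ 2 + (1 + |E₁ ρ 0| + |E₁ ρ 2| + E₂ ρ 0 2) ^ 2 +
      (1 + |E₁ ρ 1| + |E₁ ρ 2| + E₂ ρ 1 2) ^ 2 ≤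
    6 * (1 + |E₁ ρ 0|) * (1 + |E₁ ρ 1|) * (1 + |E₁ ρ 2|)

end TriangleNet

set_option linter.unusedSectionVars false

namespace TriangleNet

/-! Everything rests on one scalar, `covarianceGap`: the quadratic form of the comparison matrix at
`(1, 1, 1)`, i.e. the sum of the three variances minus twice the sum of the three covariances.

For a triangle state without shared randomness the gap is nonnegative
(`covarianceGap_tensorMap_nonneg`). Pull each `Z` back through its channel to an observable `A` with
`A² ≤ 1`. Since a party's two sources are independent, the variances of the conditional expectations
of `A` on its two halves add up to at most `Var A ≤ 1 - ⟨A⟩²` (`sum_condVariance_le`, an Efron–Stein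
bound). The covariance of two parties comes only from their common source and equals the covariance
of the corresponding conditional expectations, hence at most the mean of their variances
(`two_mul_covariance_le`). Summing over the three sources uses each conditional variance exactly
once.

A nonnegative gap limits the populations of `000` and `111`, whose total fixes the sum of the
two-body correlators (`sum_E₂`); positivity of the state relates the populations to the fidelity.
Together they give `1/√2` (`ghzFidelity_le_of_covarianceGap_nonneg`). Fidelity is linear, so the
bound survives mixing; the gap is not linear, so mixing is done last.

For (a) and (b), a large `F` makes the one-body terms small and the correlators large, which
contradicts the assumed inequality. -/

/-! ### `Z` statistics as expectations over the diagonal of the state -/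

/-- The sign `(-1)^b` of the outcome `b` of a `Z` measurement. -/
def outcomeSign (b : Fin 2) : ℝ := if b = 0 then 1 else -1

/-- The outcome of the `Z` measurement of party `i` on a basis state. -/
def zValue (i : Fin 3) (x : Qubits3) : ℝ :=
  outcomeSign (![x.1, x.2.1, x.2.2] i)

theorem zObs_eq_diagonal (i : Fin 3) :
    zObs i = Matrix.diagonal fun x => (zValue i x : ℂ) := by
  have h : pauliZ = Matrix.diagonal fun b => (outcomeSign b : ℂ) := by
    ext b c
    fin_cases b <;> fin_cases c <;> simp [pauliZ, outcomeSign]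
  have h1 : ∀ {n : Type} [DecidableEq n], (1 : Matrix n n ℂ) = Matrix.diagonal fun _ => 1 :=
    fun {n} _ => Matrix.diagonal_one.symm
  fin_cases i <;> simp [zObs, zValue, h, h1, Matrix.diagonal_kronecker_diagonal, -Matrix.diagonal_one]

theorem expect_diagonal (ρ : Matrix Qubits3 Qubits3 ℂ) (d : Qubits3 → ℝ) :
    expect ρ (Matrix.diagonal fun x => (d x : ℂ)) = ∑ x, (ρ x x).re * d x := by
  simp [expect, Matrix.trace, Matrix.mul_diagonal]

theorem E₁_eq (ρ : Matrix Qubits3 Qubits3 ℂ) (i : Fin 3) :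
    E₁ ρ i = ∑ x, (ρ x x).re * zValue i x := by
  rw [E₁, zObs_eq_diagonal, expect_diagonal]

theorem E₂_eq (ρ : Matrix Qubits3 Qubits3 ℂ) (i j : Fin 3) :
    E₂ ρ i j = ∑ x, (ρ x x).re * (zValue i x * zValue j x) := by
  rw [E₂, zObs_eq_diagonal, zObs_eq_diagonal, Matrix.diagonal_mul_diagonal, ← expect_diagonal]
  simp

/-- The comparison matrix of the covariance matrix evaluated at the vector `(1, 1, 1)`. -/
noncomputable def covarianceGap (ρ : Matrix Qubits3 Qubits3 ℂ) : ℝ :=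
  (1 - E₁ ρ 0 ^ 2) + (1 - E₁ ρ 1 ^ 2) + (1 - E₁ ρ 2 ^ 2) -
    2 * ((E₂ ρ 0 1 - E₁ ρ 0 * E₁ ρ 1) + (E₂ ρ 0 2 - E₁ ρ 0 * E₁ ρ 2) +
      (E₂ ρ 1 2 - E₁ ρ 1 * E₁ ρ 2))

theorem IsState.diag_nonneg {ρ : Matrix Qubits3 Qubits3 ℂ} (h : IsState ρ) (x : Qubits3) :
    0 ≤ (ρ x x).re :=
  (Complex.nonneg_iff.1 (h.1.diag_nonneg (i := x))).1

theorem IsState.sum_diag {ρ : Matrix Qubits3 Qubits3 ℂ} (h : IsState ρ) :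
    ∑ x, (ρ x x).re = 1 := by
  have := congrArg Complex.re h.2
  simpa [Matrix.trace] using this

theorem covarianceGap_nonneg_of_posSemidef {ρ : Matrix Qubits3 Qubits3 ℂ} (h1 : ∑ x, (ρ x x).re = 1)
    (h : (comparisonMatrix (covMatrix ρ)).PosSemidef) : 0 ≤ covarianceGap ρ := by
  have h2 : ∀ i, E₂ ρ i i = 1 := by
    intro i
    rw [E₂_eq, ← h1]
    refine Finset.sum_congr rfl fun x _ => ?_
    have : zValue i x * zValue i x = 1 := by
      unfold zValue outcomeSign
      split_ifs <;> norm_num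
    rw [this, mul_one]
  have hs : ∀ i j, E₂ ρ i j = E₂ ρ j i := by
    intro i j
    simp only [E₂_eq, mul_comm]
  have := h.dotProduct_mulVec_nonneg (fun _ => (1 : ℝ))
  simp [dotProduct, Matrix.mulVec, Fin.sum_univ_three, comparisonMatrix, covMatrix, h2] at this
  rw [hs 1 0, hs 2 0, hs 2 1] at this
  unfold covarianceGap
  nlinarith [this]

/-- The three pairwise products of signs sum to `3` when all signs agree and to `-1` otherwise. -/
theorem sum_E₂ {ρ : Matrix Qubits3 Qubits3 ℂ} (h1 : ∑ x, (ρ x x).re = 1) :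
    E₂ ρ 0 1 + E₂ ρ 0 2 + E₂ ρ 1 2 =
      4 * ((ρ (0, 0, 0) (0, 0, 0)).re + (ρ (1, 1, 1) (1, 1, 1)).re) - 1 := by
  simp [Fintype.sum_prod_type, E₂_eq, zValue, outcomeSign] at h1 ⊢
  linarith

/-! ### Mixtures with GHZ: criteria (a) and (b) -/

theorem ghzMix_diag (F : ℝ) (σ : Matrix Qubits3 Qubits3 ℂ) (x : Qubits3) :
    (ghzMix F σ x x).re =
      F * (if x = (0, 0, 0) ∨ x = (1, 1, 1) then 1 / 2 else 0) + (1 - F) * (σ x x).re := by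
  have h2 : √2 / 2 * (√2 / 2) = (2⁻¹ : ℝ) := by
    rw [div_mul_div_comm, Real.mul_self_sqrt (by norm_num)]; norm_num
  obtain ⟨a, b, c⟩ := x
  simp only [ghzMix, Matrix.add_apply, Matrix.smul_apply, Matrix.vecMulVec_apply, smul_eq_mul,
    Complex.add_re, Complex.re_ofReal_mul]
  congr 2
  fin_cases a <;> fin_cases b <;> fin_cases c <;> simp [ghz, h2]

/-- The GHZ component has vanishing one-body `Z` expectations, so only `σ` contributes. -/
theorem abs_E₁_ghzMix_le {F : ℝ} {σ : Matrix Qubits3 Qubits3 ℂ} (hF : F ≤ 1) (hσ : IsState σ)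
    (i : Fin 3) : |E₁ (ghzMix F σ) i| ≤ 1 - F := by
  have hd := hσ.diag_nonneg
  have h1 := hσ.sum_diag
  have h2 : E₁ (ghzMix F σ) i = (1 - F) * E₁ σ i := by
    simp only [E₁_eq, ghzMix_diag, Fintype.sum_prod_type]
    fin_cases i <;> simp [zValue, outcomeSign] <;> ring
  have h3 : |E₁ σ i| ≤ 1 := by
    rw [E₁_eq, ← h1]
    refine (Finset.abs_sum_le_sum_abs _ _).trans (Finset.sum_le_sum fun x _ => ?_)
    have : |zValue i x| = 1 := by
      unfold zValue outcomeSign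
      split_ifs <;> simp
    rw [abs_mul, this, mul_one, abs_of_nonneg (hd x)]
  rw [h2, abs_mul, abs_of_nonneg (sub_nonneg.2 hF)]
  exact mul_le_of_le_one_right (sub_nonneg.2 hF) h3

theorem ghzMix_sum_diag {F : ℝ} {σ : Matrix Qubits3 Qubits3 ℂ} (hσ : IsState σ) :
    ∑ x, (ghzMix F σ x x).re = 1 := by
  have h1 := hσ.sum_diag
  simp only [ghzMix_diag, Finset.sum_add_distrib, ← Finset.mul_sum, h1]
  simp [Fintype.sum_prod_type]
  ring

theorem le_ghzMix_populations {F : ℝ} {σ : Matrix Qubits3 Qubits3 ℂ} (hF : F ≤ 1)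
    (hσ : IsState σ) :
    F ≤ (ghzMix F σ (0, 0, 0) (0, 0, 0)).re + (ghzMix F σ (1, 1, 1) (1, 1, 1)).re := by
  rw [ghzMix_diag, ghzMix_diag]
  have h0 := mul_nonneg (sub_nonneg.2 hF) (hσ.diag_nonneg (0, 0, 0))
  have h1 := mul_nonneg (sub_nonneg.2 hF) (hσ.diag_nonneg (1, 1, 1))
  norm_num
  linarith

theorem le_three_quarters_of_posSemidef {F : ℝ} {σ : Matrix Qubits3 Qubits3 ℂ} (hF : F ≤ 1)
    (hσ : IsState σ) (h : (comparisonMatrix (covMatrix (ghzMix F σ))).PosSemidef) :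
    F ≤ 3 / 4 := by
  have hgap := covarianceGap_nonneg_of_posSemidef (ghzMix_sum_diag hσ) h
  have hs := sum_E₂ (ghzMix_sum_diag (F := F) hσ)
  have hp := le_ghzMix_populations hF hσ
  have he : ∀ i, E₁ (ghzMix F σ) i ^ 2 ≤ (1 - F) ^ 2 := fun i =>
    sq_le_sq' (abs_le.1 (abs_E₁_ghzMix_le hF hσ i)).1 (abs_le.1 (abs_E₁_ghzMix_le hF hσ i)).2
  unfold covarianceGap at hgap
  by_contra hc
  push Not at hc
  have := he 0
  have := he 1
  have := he 2
  have : (1 - F) ^ 2 ≤ 1 / 16 := by nlinarith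
  -- The squares bound the gap by `5 - 8F + ∑ Eᵢ²`, which is negative once `F > 3/4` and each `Eᵢ² ≤
  -- 1/16`.
  nlinarith [sq_nonneg (E₁ (ghzMix F σ) 0 - E₁ (ghzMix F σ) 1),
    sq_nonneg (E₁ (ghzMix F σ) 0 - E₁ (ghzMix F σ) 2),
    sq_nonneg (E₁ (ghzMix F σ) 1 - E₁ (ghzMix F σ) 2)]

theorem le_inv_sqrt_two_iff {F : ℝ} (hF : 0 ≤ F) : F ≤ 1 / Real.sqrt 2 ↔ 2 * F ^ 2 ≤ 1 := by
  have h2 : Real.sqrt 2 ^ 2 = 2 := Real.sq_sqrt (by norm_num)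
  have hpos : 0 < Real.sqrt 2 := by positivity
  rw [le_div_iff₀ hpos, ← sq_le_one_iff₀ (by positivity), mul_pow, h2, mul_comm]

/-- With `S = a + b + c`, the product is at most `1 + 1.33 S` (from `1 + 0.3 + 0.03`), while the sum
of squares is at least a third of the square of the sum. The thresholds are those forced by `F ≥
0.7071`: `1 - F ≤ 0.3` and `4F - 1 ≥ 1.8`. -/
theorem gisin_violation {a b c u v w : ℝ} (ha : 0 ≤ a) (hb : 0 ≤ b) (hc : 0 ≤ c)
    (ha' : a ≤ 3 / 10) (hb' : b ≤ 3 / 10) (hc' : c ≤ 3 / 10) (hs : 9 / 5 ≤ u + v + w) :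
    6 * (1 + a) * (1 + b) * (1 + c) <
      (1 + a + b + u) ^ 2 + (1 + a + c + v) ^ 2 + (1 + b + c + w) ^ 2 := by
  have hab : a * b ≤ 3 / 10 * b := mul_le_mul_of_nonneg_right ha' hb
  have hac : a * c ≤ a * (3 / 10) := mul_le_mul_of_nonneg_left hc' ha
  have hbc : b * c ≤ 3 / 10 * c := mul_le_mul_of_nonneg_right hb' hc
  have habc : a * b * c ≤ 3 / 10 * b * (3 / 10) := mul_le_mul hab hc' hc (by positivity)
  have habc' : a * b * c ≤ 3 / 10 * (3 / 10 * c) := by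
    rw [mul_assoc]; exact mul_le_mul ha' hbc (by positivity) (by norm_num)
  have habc'' : a * b * c ≤ a * (3 / 10) * (3 / 10) := by
    rw [mul_right_comm]; exact mul_le_mul hac hb' hb (by positivity)
  have hprod : (1 + a) * (1 + b) * (1 + c) ≤ 1 + 133 / 100 * (a + b + c) := by
    ring_nf at *
    linarith
  have hsq : (24 / 5 + 2 * (a + b + c)) ^ 2 ≤ (3 + 2 * (a + b + c) + (u + v + w)) ^ 2 :=
    pow_le_pow_left₀ (by positivity) (by linarith) 2
  have hqm : (3 + 2 * (a + b + c) + (u + v + w)) ^ 2 ≤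
      3 * ((1 + a + b + u) ^ 2 + (1 + a + c + v) ^ 2 + (1 + b + c + w) ^ 2) := by
    have h := add_nonneg (add_nonneg (sq_nonneg ((1 + a + b + u) - (1 + a + c + v)))
      (sq_nonneg ((1 + a + b + u) - (1 + b + c + w))))
      (sq_nonneg ((1 + a + c + v) - (1 + b + c + w)))
    linarith
  -- Tangent line at `S = 0.6`, which linearises the remaining quadratic in `S`.
  have := sq_nonneg (a + b + c - 6 / 10)
  linarith

theorem le_inv_sqrt_two_of_gisinInequality {F : ℝ} {σ : Matrix Qubits3 Qubits3 ℂ} (hF0 : 0 ≤ F)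
    (hF : F ≤ 1) (hσ : IsState σ) (h : GisinInequality (ghzMix F σ)) : F ≤ 1 / Real.sqrt 2 := by
  have hs := sum_E₂ (ghzMix_sum_diag (F := F) hσ)
  have hp := le_ghzMix_populations hF hσ
  have he0 := abs_E₁_ghzMix_le hF hσ 0
  have he1 := abs_E₁_ghzMix_le hF hσ 1
  have he2 := abs_E₁_ghzMix_le hF hσ 2
  unfold GisinInequality at h
  generalize E₂ (ghzMix F σ) 0 1 = z₀₁ at *
  generalize E₂ (ghzMix F σ) 0 2 = z₀₂ at *
  generalize E₂ (ghzMix F σ) 1 2 = z₁₂ at *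
  have hn0 := abs_nonneg (E₁ (ghzMix F σ) 0)
  have hn1 := abs_nonneg (E₁ (ghzMix F σ) 1)
  have hn2 := abs_nonneg (E₁ (ghzMix F σ) 2)
  generalize |E₁ (ghzMix F σ) 0| = a at *
  generalize |E₁ (ghzMix F σ) 1| = b at *
  generalize |E₁ (ghzMix F σ) 2| = c at *
  rw [le_inv_sqrt_two_iff hF0]
  by_contra hc
  push Not at hc
  have hF' : 7071 / 10000 ≤ F := by nlinarith
  have hk : 1 - F ≤ 3 / 10 := by linarith
  rw [← not_lt] at h
  refine h (gisin_violation hn0 hn1 hn2 (by linarith) (by linarith) (by linarith) (by linarith))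

/-! ### From a nonnegative gap to the fidelity bound -/

/-- The three signs sum to `±3` on `000` and `111`, and to `±1` on every other basis state. -/
theorem sum_E₁_abs_le {ρ : Matrix Qubits3 Qubits3 ℂ} (hρ : IsState ρ) :
    |E₁ ρ 0 + E₁ ρ 1 + E₁ ρ 2| ≤
      3 * |(ρ (0, 0, 0) (0, 0, 0)).re - (ρ (1, 1, 1) (1, 1, 1)).re| +
        (1 - (ρ (0, 0, 0) (0, 0, 0)).re - (ρ (1, 1, 1) (1, 1, 1)).re) := by
  have hd := hρ.diag_nonneg
  have h1 := hρ.sum_diag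
  simp [Fintype.sum_prod_type, E₁_eq, zValue, outcomeSign] at h1 ⊢
  have := hd (0, 0, 1)
  have := hd (0, 1, 0)
  have := hd (1, 0, 0)
  have := hd (1, 1, 0)
  have := hd (1, 0, 1)
  have := hd (0, 1, 1)
  have := le_abs_self ((ρ (0, 0, 0) (0, 0, 0)).re - (ρ (1, 1, 1) (1, 1, 1)).re)
  have := neg_abs_le ((ρ (0, 0, 0) (0, 0, 0)).re - (ρ (1, 1, 1) (1, 1, 1)).re)
  rw [abs_le]
  constructor <;> linarith

theorem ghzFidelity_eq (ρ : Matrix Qubits3 Qubits3 ℂ) :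
    ghzFidelity ρ = ((ρ (0, 0, 0) (0, 0, 0)).re + (ρ (0, 0, 0) (1, 1, 1)).re +
      (ρ (1, 1, 1) (0, 0, 0)).re + (ρ (1, 1, 1) (1, 1, 1)).re) / 2 := by
  have h2 : (Real.sqrt 2)⁻¹ * (Real.sqrt 2)⁻¹ = 1 / 2 := by
    rw [← mul_inv, Real.mul_self_sqrt (by norm_num)]; norm_num
  have h3 : ((Real.sqrt 2 : ℂ))⁻¹ * (Real.sqrt 2 : ℂ)⁻¹ = ((1 / 2 : ℝ) : ℂ) := by
    rw [← h2]; push_cast; rfl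
  have : star ghz ⬝ᵥ ρ *ᵥ ghz = ((1 / 2 : ℝ) : ℂ) * (ρ (0, 0, 0) (0, 0, 0) +
      ρ (0, 0, 0) (1, 1, 1) + ρ (1, 1, 1) (0, 0, 0) + ρ (1, 1, 1) (1, 1, 1)) := by
    rw [← h3]
    simp [ghz, Matrix.mulVec_add, Matrix.mulVec_smul, dotProduct_add, Matrix.mulVec_single]
    ring
  rw [ghzFidelity, this, Complex.re_ofReal_mul]
  simp
  ring

/-- Positivity of `ρ` on `s|000⟩ - t|111⟩`; the off-diagonal term is expressed through the fidelity.
-/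
theorem ghzFidelity_le_populations {ρ : Matrix Qubits3 Qubits3 ℂ} (hρ : ρ.PosSemidef) (s : ℝ)
    (t : ℝ) :
    2 * s * t * (2 * ghzFidelity ρ - (ρ (0, 0, 0) (0, 0, 0)).re - (ρ (1, 1, 1) (1, 1, 1)).re) ≤
      2 * (s ^ 2 * (ρ (0, 0, 0) (0, 0, 0)).re + t ^ 2 * (ρ (1, 1, 1) (1, 1, 1)).re) := by
  have := (Complex.nonneg_iff.1 (hρ.dotProduct_mulVec_nonneg
    ((s : ℂ) • Pi.single (0, 0, 0) 1 - (t : ℂ) • Pi.single (1, 1, 1) 1))).1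
  simp [Matrix.mulVec_sub, Matrix.mulVec_smul, dotProduct_sub, Matrix.mulVec_single] at this
  rw [ghzFidelity_eq]
  nlinarith

theorem le_inv_sqrt_two_of_populations {F x y e : ℝ} (hx : 0 ≤ x) (hy : 0 ≤ y)
    (hxy : x + y ≤ 1) (hF : ∀ s t : ℝ, 2 * s * t * (2 * F - x - y) ≤ 2 * (s ^ 2 * x + t ^ 2 * y))
    (he : |e| ≤ 3 * |x - y| + (1 - x - y)) (hg : 8 * (x + y) ≤ 5 + e ^ 2 / 3) :
    F ≤ 1 / Real.sqrt 2 := by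
  rcases le_or_gt F 0 with hF0 | hF0
  · exact hF0.trans (by positivity)
  rw [le_inv_sqrt_two_iff hF0.le]
  by_contra hc
  push Not at hc
  have hF' : 7071 / 10000 ≤ F := by nlinarith
  -- The determinant condition of the `2 × 2` block, obtained by choosing `s` and `t`; `x = 0` needs
  -- its own choice because `x` is cancelled otherwise.
  have hm : (2 * F - x - y) ^ 2 ≤ 4 * x * y := by
    rcases hx.eq_or_lt with rfl | hx
    · have := hF (y + 1) (2 * F - 0 - y)
      linarith
    · have := hF (2 * F - x - y) (2 * x)
      have : x * (2 * F - x - y) ^ 2 ≤ x * (4 * x * y) := by linarith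
      exact le_of_mul_le_mul_left this hx
  have hg1 : F ≤ x + y := by
    have h1 : (2 * F - x - y) ^ 2 ≤ (x + y) ^ 2 := by linarith [sq_nonneg (x - y)]
    linarith [(abs_le_of_sq_le_sq' h1 (by positivity)).2]
  -- `hm` rearranges to `|x - y|² ≤ 4F(1 - F) - 4F(1 - x - y)`; the constants are its values at `F =
  -- 0.7071`, the first rounded up.
  have hd : |x - y| ^ 2 ≤ 8285 / 10000 - 28284 / 10000 * (1 - x - y) := by
    have h1 : |x - y| ^ 2 ≤ 4 * F * (x + y - F) := by
      rw [sq_abs]; linarith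
    nlinarith [mul_nonneg (sub_nonneg.2 hF') (sub_nonneg.2 hF')]
  have hd0 := abs_nonneg (x - y)
  generalize |x - y| = d at *
  have hh : 0 ≤ 1 - x - y := by linarith
  have hh' : 1 - x - y ≤ 293 / 1000 := by linarith
  generalize hdef : 1 - x - y = h at *
  have hd1 : d ≤ 1 := by
    rw [← sq_le_one_iff₀ hd0]; linarith
  have he2 : e ^ 2 ≤ (3 * d + h) ^ 2 := sq_le_sq' (abs_le.1 he).1 (abs_le.1 he).2
  have hdh : d * h ≤ h := mul_le_of_le_one_left hh hd1
  have hhh : h * h ≤ 293 / 1000 * h := mul_le_mul_of_nonneg_right hh' hh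
  linarith

theorem ghzFidelity_le_of_covarianceGap_nonneg {ρ : Matrix Qubits3 Qubits3 ℂ} (hρ : IsState ρ)
    (h : 0 ≤ covarianceGap ρ) : ghzFidelity ρ ≤ 1 / Real.sqrt 2 := by
  have hd := hρ.diag_nonneg
  have h1 := hρ.sum_diag
  have hs := sum_E₂ h1
  refine le_inv_sqrt_two_of_populations (hd (0, 0, 0)) (hd (1, 1, 1)) ?_
    (ghzFidelity_le_populations hρ.1) (sum_E₁_abs_le hρ) ?_
  · rw [← h1, ← Finset.sum_pair (f := fun x => (ρ x x).re)
      (show ((0, 0, 0) : Qubits3) ≠ (1, 1, 1) by decide)]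
    exact Finset.sum_le_univ_sum_of_nonneg hd
  · unfold covarianceGap at h
    have h3 := add_nonneg (add_nonneg (sq_nonneg (E₁ ρ 0 - E₁ ρ 1)) (sq_nonneg (E₁ ρ 0 - E₁ ρ 2)))
      (sq_nonneg (E₁ ρ 1 - E₁ ρ 2))
    linarith

/-! ### Conditional expectations and variances in bipartite systems -/

section Functional

variable {m n : Type*} [Fintype m] [Fintype n]

/-- The marginal of a bipartite matrix on the first subsystem. -/
def marginalLeft (ρ : Matrix (m × n) (m × n) ℂ) : Matrix m m ℂ :=
  Matrix.of fun i i' => ∑ j, ρ (i, j) (i', j)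

/-- The marginal of a bipartite matrix on the second subsystem. -/
def marginalRight (ρ : Matrix (m × n) (m × n) ℂ) : Matrix n n ℂ :=
  Matrix.of fun j j' => ∑ i, ρ (i, j) (i, j')

/-- The operator `Tr_n[(1 ⊗ ω) A]` on the first subsystem. -/
def condLeft (ω : Matrix n n ℂ) (A : Matrix (m × n) (m × n) ℂ) : Matrix m m ℂ :=
  Matrix.of fun i i' => ∑ j, ∑ j', ω j j' * A (i, j') (i', j)

/-- The operator `Tr_m[(γ ⊗ 1) A]` on the second subsystem. -/
def condRight (γ : Matrix m m ℂ) (A : Matrix (m × n) (m × n) ℂ) : Matrix n n ℂ :=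
  Matrix.of fun j j' => ∑ i, ∑ i', γ i i' * A (i', j) (i, j')

theorem condRight_eq_condLeft (γ : Matrix m m ℂ) (A : Matrix (m × n) (m × n) ℂ) :
    condRight γ A = condLeft γ (A.submatrix Prod.swap Prod.swap) := rfl

theorem trace_kronecker_mul_eq_left (γ : Matrix m m ℂ) (ω : Matrix n n ℂ)
    (A : Matrix (m × n) (m × n) ℂ) : ((γ ⊗ₖ ω) * A).trace = (γ * condLeft ω A).trace := by
  simp only [Matrix.trace, Matrix.diag, Matrix.mul_apply, Fintype.sum_prod_type,
    Matrix.kroneckerMap_apply, condLeft, Matrix.of_apply, Finset.mul_sum]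
  refine Finset.sum_congr rfl fun i _ => ?_
  rw [Finset.sum_comm]
  simp only [mul_assoc]

theorem trace_kronecker_mul_eq_right (γ : Matrix m m ℂ) (ω : Matrix n n ℂ)
    (A : Matrix (m × n) (m × n) ℂ) : ((γ ⊗ₖ ω) * A).trace = (ω * condRight γ A).trace := by
  rw [condRight_eq_condLeft, ← trace_kronecker_mul_eq_left]
  simp only [Matrix.trace, Matrix.diag, Matrix.mul_apply, Fintype.sum_prod_type,
    Matrix.kroneckerMap_apply, Matrix.submatrix_apply, Prod.swap]
  rw [Finset.sum_comm]
  refine Finset.sum_congr rfl fun i _ => Finset.sum_congr rfl fun j _ => ?_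
  rw [Finset.sum_comm]
  simp only [mul_comm (γ _ _)]

theorem condLeft_mul_kronecker_one [DecidableEq n] (ω : Matrix n n ℂ)
    (A : Matrix (m × n) (m × n) ℂ) (X : Matrix m m ℂ) :
    condLeft ω (A * (X ⊗ₖ 1)) = condLeft ω A * X := by
  have h : ∀ x i' j', (A * (X ⊗ₖ (1 : Matrix n n ℂ))) x (i', j') = ∑ k, A x (k, j') * X k i' := by
    intro x i' j'
    simp [Matrix.mul_apply, Fintype.sum_prod_type, Matrix.one_apply]
  ext i i'
  simp only [condLeft, Matrix.of_apply, Matrix.mul_apply, h, Finset.mul_sum, Finset.sum_mul]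
  rw [Finset.sum_comm (s := (Finset.univ : Finset m))]
  refine Finset.sum_congr rfl fun j _ => ?_
  rw [Finset.sum_comm]
  simp only [mul_assoc]

theorem condLeft_kronecker_one_mul [DecidableEq n] (ω : Matrix n n ℂ)
    (A : Matrix (m × n) (m × n) ℂ) (X : Matrix m m ℂ) :
    condLeft ω ((X ⊗ₖ 1) * A) = X * condLeft ω A := by
  have h : ∀ y i j, ((X ⊗ₖ (1 : Matrix n n ℂ)) * A) (i, j) y = ∑ k, X i k * A (k, j) y := by
    intro x i' j'
    simp [Matrix.mul_apply, Fintype.sum_prod_type, Matrix.one_apply]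
  ext i i'
  simp only [condLeft, Matrix.of_apply, Matrix.mul_apply, h, Finset.mul_sum]
  rw [Finset.sum_comm (s := (Finset.univ : Finset m))]
  refine Finset.sum_congr rfl fun j _ => ?_
  rw [Finset.sum_comm]
  simp only [mul_left_comm]

theorem one_kronecker_submatrix_swap [DecidableEq m] (Y : Matrix n n ℂ) :
    ((1 : Matrix m m ℂ) ⊗ₖ Y).submatrix Prod.swap Prod.swap = Y ⊗ₖ 1 := by
  ext ⟨a, b⟩ ⟨c, d⟩
  simp [mul_comm]

theorem condRight_mul_one_kronecker [DecidableEq m] (γ : Matrix m m ℂ)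
    (A : Matrix (m × n) (m × n) ℂ) (Y : Matrix n n ℂ) :
    condRight γ (A * (1 ⊗ₖ Y)) = condRight γ A * Y := by
  rw [condRight_eq_condLeft, condRight_eq_condLeft, ← condLeft_mul_kronecker_one,
    ← one_kronecker_submatrix_swap]
  exact congrArg _ (Matrix.submatrix_mul_equiv _ _ _ (Equiv.prodComm n m) _).symm

theorem condRight_one_kronecker_mul [DecidableEq m] (γ : Matrix m m ℂ)
    (A : Matrix (m × n) (m × n) ℂ) (Y : Matrix n n ℂ) :
    condRight γ ((1 ⊗ₖ Y) * A) = Y * condRight γ A := by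
  rw [condRight_eq_condLeft, condRight_eq_condLeft, ← condLeft_kronecker_one_mul,
    ← one_kronecker_submatrix_swap]
  exact congrArg _ (Matrix.submatrix_mul_equiv _ _ _ (Equiv.prodComm n m) _).symm

theorem condLeft_one [DecidableEq m] [DecidableEq n] (ω : Matrix n n ℂ) :
    condLeft ω (1 : Matrix (m × n) (m × n) ℂ) = ω.trace • 1 := by
  ext i i'
  by_cases h : i = i' <;>
    simp [condLeft, Matrix.one_apply, Matrix.trace, h]

theorem condRight_one [DecidableEq m] [DecidableEq n] (γ : Matrix m m ℂ) :
    condRight γ (1 : Matrix (m × n) (m × n) ℂ) = γ.trace • 1 := by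
  ext i i'
  by_cases h : i = i' <;>
    simp [condRight, Matrix.one_apply, Matrix.trace, h]

theorem isHermitian_condLeft {ω : Matrix n n ℂ} (hω : ω.IsHermitian)
    {A : Matrix (m × n) (m × n) ℂ} (hA : A.IsHermitian) : (condLeft ω A).IsHermitian := by
  ext i i'
  simp only [condLeft, Matrix.conjTranspose_apply, Matrix.of_apply, star_sum, star_mul', hω.apply,
    hA.apply]
  rw [Finset.sum_comm]

theorem isHermitian_condRight {γ : Matrix m m ℂ} (hγ : γ.IsHermitian)
    {A : Matrix (m × n) (m × n) ℂ} (hA : A.IsHermitian) : (condRight γ A).IsHermitian := by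
  rw [condRight_eq_condLeft]
  exact isHermitian_condLeft hγ (hA.submatrix Prod.swap)

theorem trace_mul_kronecker_one [DecidableEq n] (ρ : Matrix (m × n) (m × n) ℂ) (X : Matrix m m ℂ) :
    (ρ * (X ⊗ₖ 1)).trace = (marginalLeft ρ * X).trace := by
  simp only [Matrix.trace, Matrix.diag, Matrix.mul_apply, Fintype.sum_prod_type,
    Matrix.kroneckerMap_apply, marginalLeft, Matrix.of_apply, Matrix.one_apply, mul_ite, mul_one,
    mul_zero, Finset.sum_ite_eq', Finset.mem_univ, if_true, Finset.sum_mul]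
  exact Finset.sum_congr rfl fun i _ => Finset.sum_comm

theorem trace_mul_one_kronecker [DecidableEq m] (ρ : Matrix (m × n) (m × n) ℂ) (Y : Matrix n n ℂ) :
    (ρ * (1 ⊗ₖ Y)).trace = (marginalRight ρ * Y).trace := by
  simp only [Matrix.trace, Matrix.diag, Matrix.mul_apply, Fintype.sum_prod_type,
    Matrix.kroneckerMap_apply, marginalRight, Matrix.of_apply, Matrix.one_apply, mul_ite, ite_mul,
    one_mul, mul_zero, zero_mul, Finset.sum_mul]
  rw [Finset.sum_comm]
  simp
  exact Finset.sum_congr rfl fun i _ => Finset.sum_comm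

theorem trace_mul_sq_nonneg {ρ : Matrix n n ℂ} (hρ : ρ.PosSemidef) {T : Matrix n n ℂ}
    (hT : T.IsHermitian) : 0 ≤ (ρ * (T * T)).trace := by
  have h := (hρ.mul_mul_conjTranspose_same T).trace_nonneg
  rwa [hT.eq, Matrix.trace_mul_comm, ← mul_assoc, Matrix.trace_mul_comm] at h

theorem isState_marginalLeft {ρ : Matrix (m × n) (m × n) ℂ} (hρ : IsState ρ) :
    IsState (marginalLeft ρ) := by
  refine ⟨?_, ?_⟩
  · have : marginalLeft ρ = ∑ j, ρ.submatrix (fun i => (i, j)) (fun i => (i, j)) := by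
      ext i i'
      simp [marginalLeft, Matrix.sum_apply]
    rw [this]
    exact Matrix.posSemidef_sum _ fun j _ => hρ.1.submatrix _
  · rw [← hρ.2]
    simp [marginalLeft, Matrix.trace, Fintype.sum_prod_type]

theorem isState_marginalRight {ρ : Matrix (m × n) (m × n) ℂ} (hρ : IsState ρ) :
    IsState (marginalRight ρ) := by
  refine ⟨?_, ?_⟩
  · have : marginalRight ρ = ∑ i, ρ.submatrix (fun j => (i, j)) (fun j => (i, j)) := by
      ext i i'
      simp [marginalRight, Matrix.sum_apply]
    rw [this]
    exact Matrix.posSemidef_sum _ fun j _ => hρ.1.submatrix _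
  · rw [← hρ.2]
    simp [marginalRight, Matrix.trace, Fintype.sum_prod_type_right]

theorem ofReal_re_trace_mul {ρ A : Matrix n n ℂ} (hρ : ρ.IsHermitian) (hA : A.IsHermitian) :
    ((ρ * A).trace.re : ℂ) = (ρ * A).trace := by
  rw [← Complex.conj_eq_iff_re]
  have := Matrix.trace_conjTranspose (ρ * A)
  rw [Matrix.conjTranspose_mul, hρ.eq, hA.eq, Matrix.trace_mul_comm] at this
  exact this.symm

/-- In a product state the variances of the two conditional expectations of `A` add up to at most
the variance of `A`. -/
theorem sum_condVariance_le {γ : Matrix m m ℂ} {ω : Matrix n n ℂ} [DecidableEq m] [DecidableEq n]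
    (hγ : IsState γ) (hω : IsState ω) {A : Matrix (m × n) (m × n) ℂ} (hA : A.IsHermitian) :
    (γ * (condLeft ω A * condLeft ω A)).trace.re + (ω * (condRight γ A * condRight γ A)).trace.re ≤
      ((γ ⊗ₖ ω) * (A * A)).trace.re + ((γ ⊗ₖ ω) * A).trace.re ^ 2 := by
  have hX := isHermitian_condLeft hω.1.1 hA
  have hY := isHermitian_condRight hγ.1.1 hA
  set X := condLeft ω A with hXdef
  set Y := condRight γ A with hYdef
  have hP := hγ.1.kronecker hω.1
  have htr : (γ ⊗ₖ ω).trace = 1 := by rw [Matrix.trace_kronecker, hγ.2, hω.2, one_mul]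
  obtain ⟨e, he⟩ : ∃ e : ℝ, (e : ℂ) = ((γ ⊗ₖ ω) * A).trace :=
    ⟨_, ofReal_re_trace_mul hP.1 hA⟩
  have heX : (γ * X).trace = e := by rw [he, trace_kronecker_mul_eq_left]
  have heY : (ω * Y).trace = e := by rw [he, trace_kronecker_mul_eq_right]
  have hX1 : (X ⊗ₖ (1 : Matrix n n ℂ)).IsHermitian := by
    rw [Matrix.IsHermitian, Matrix.conjTranspose_kronecker, hX.eq, Matrix.conjTranspose_one]
  have hY1 : ((1 : Matrix m m ℂ) ⊗ₖ Y).IsHermitian := by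
    rw [Matrix.IsHermitian, Matrix.conjTranspose_kronecker, hY.eq, Matrix.conjTranspose_one]
  have he1 : ((e : ℂ) • (1 : Matrix (m × n) (m × n) ℂ)).IsHermitian := by
    rw [Matrix.IsHermitian, Matrix.conjTranspose_smul, Matrix.conjTranspose_one]
    simp
  -- The operator is `(A - e) - (X - e) ⊗ 1 - 1 ⊗ (Y - e)`, the residual after removing both
  -- one-body parts; its second moment is `Var A - Var X - Var Y`.
  have key := trace_mul_sq_nonneg hP (((hA.add he1).sub hX1).sub hY1)
  have h1 : ((γ ⊗ₖ ω) * (A * (X ⊗ₖ 1))).trace = (γ * (X * X)).trace := by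
    rw [trace_kronecker_mul_eq_left, condLeft_mul_kronecker_one]
  have h2 : ((γ ⊗ₖ ω) * ((X ⊗ₖ 1) * A)).trace = (γ * (X * X)).trace := by
    rw [trace_kronecker_mul_eq_left, condLeft_kronecker_one_mul]
  have h3 : ((γ ⊗ₖ ω) * (A * (1 ⊗ₖ Y))).trace = (ω * (Y * Y)).trace := by
    rw [trace_kronecker_mul_eq_right, condRight_mul_one_kronecker]
  have h4 : ((γ ⊗ₖ ω) * ((1 ⊗ₖ Y) * A)).trace = (ω * (Y * Y)).trace := by
    rw [trace_kronecker_mul_eq_right, condRight_one_kronecker_mul]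
  have h5 : ((γ ⊗ₖ ω) * ((X ⊗ₖ 1) * (X ⊗ₖ 1))).trace = (γ * (X * X)).trace := by
    simp only [← Matrix.mul_kronecker_mul, mul_one, Matrix.trace_kronecker, hω.2]
  have h6 : ((γ ⊗ₖ ω) * ((1 ⊗ₖ Y) * (1 ⊗ₖ Y))).trace = (ω * (Y * Y)).trace := by
    simp only [← Matrix.mul_kronecker_mul, mul_one, one_mul, Matrix.trace_kronecker, hγ.2]
  have h7 : ((γ ⊗ₖ ω) * ((X ⊗ₖ 1) * (1 ⊗ₖ Y))).trace = (e : ℂ) * e := by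
    simp only [← Matrix.mul_kronecker_mul, mul_one, one_mul, Matrix.trace_kronecker, heX, heY]
  have h8 : ((γ ⊗ₖ ω) * ((1 ⊗ₖ Y) * (X ⊗ₖ 1))).trace = (e : ℂ) * e := by
    simp only [← Matrix.mul_kronecker_mul, mul_one, one_mul, Matrix.trace_kronecker, heX, heY]
  have h9 : ((γ ⊗ₖ ω) * (X ⊗ₖ 1)).trace = (e : ℂ) := by
    simp only [← Matrix.mul_kronecker_mul, mul_one, Matrix.trace_kronecker, heX, hω.2]
  have h10 : ((γ ⊗ₖ ω) * (1 ⊗ₖ Y)).trace = (e : ℂ) := by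
    simp only [← Matrix.mul_kronecker_mul, mul_one, one_mul, Matrix.trace_kronecker, heY, hγ.2]
  simp only [mul_add, mul_sub, add_mul, sub_mul, Matrix.trace_add, Matrix.trace_sub, h1, h2, h3,
    h4, h5, h6, h7, h8, h9, h10, htr, ← he, Matrix.mul_smul, Matrix.smul_mul, mul_one, one_mul,
    Matrix.trace_smul, smul_eq_mul] at key
  have := (Complex.nonneg_iff.1 key).1
  rw [← he]
  simp at this ⊢
  linarith

/-- The covariance of two local observables in a bipartite state is at most the mean of their
variances. -/
theorem two_mul_covariance_le [DecidableEq m] [DecidableEq n] {ρ : Matrix (m × n) (m × n) ℂ}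
    (hρ : IsState ρ) {X : Matrix m m ℂ} {Y : Matrix n n ℂ} (hX : X.IsHermitian)
    (hY : Y.IsHermitian) {x y : ℝ} (hx : (marginalLeft ρ * X).trace = x)
    (hy : (marginalRight ρ * Y).trace = y) :
    2 * ((ρ * (X ⊗ₖ Y)).trace.re - x * y) ≤
      ((marginalLeft ρ * (X * X)).trace.re - x ^ 2) +
        ((marginalRight ρ * (Y * Y)).trace.re - y ^ 2) := by
  have hX1 : (X ⊗ₖ (1 : Matrix n n ℂ)).IsHermitian := by
    rw [Matrix.IsHermitian, Matrix.conjTranspose_kronecker, hX.eq, Matrix.conjTranspose_one]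
  have hY1 : ((1 : Matrix m m ℂ) ⊗ₖ Y).IsHermitian := by
    rw [Matrix.IsHermitian, Matrix.conjTranspose_kronecker, hY.eq, Matrix.conjTranspose_one]
  have he1 : (((x - y : ℝ) : ℂ) • (1 : Matrix (m × n) (m × n) ℂ)).IsHermitian := by
    rw [Matrix.IsHermitian, Matrix.conjTranspose_smul, Matrix.conjTranspose_one]
    simp
  -- The variance of `X ⊗ 1 - 1 ⊗ Y` is nonnegative.
  have key := trace_mul_sq_nonneg hρ.1 ((hX1.sub hY1).sub he1)
  have h1 : (X ⊗ₖ (1 : Matrix n n ℂ)) * (X ⊗ₖ 1) = (X * X) ⊗ₖ 1 := by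
    rw [← Matrix.mul_kronecker_mul, mul_one]
  have h2 : ((1 : Matrix m m ℂ) ⊗ₖ Y) * (1 ⊗ₖ Y) = 1 ⊗ₖ (Y * Y) := by
    rw [← Matrix.mul_kronecker_mul, mul_one]
  have h3 : (X ⊗ₖ (1 : Matrix n n ℂ)) * (1 ⊗ₖ Y) = X ⊗ₖ Y := by
    rw [← Matrix.mul_kronecker_mul, mul_one, one_mul]
  have h4 : ((1 : Matrix m m ℂ) ⊗ₖ Y) * (X ⊗ₖ 1) = X ⊗ₖ Y := by
    rw [← Matrix.mul_kronecker_mul, mul_one, one_mul]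
  simp only [mul_sub, sub_mul, Matrix.trace_sub, h1, h2, h3, h4, Matrix.mul_smul, Matrix.smul_mul,
    mul_one, one_mul, Matrix.trace_smul, smul_eq_mul, trace_mul_kronecker_one,
    trace_mul_one_kronecker, hρ.2, hx, hy] at key
  have := (Complex.nonneg_iff.1 key).1
  simp at this ⊢
  linarith

end Functional

/-! ### Channels and dual observables -/

section Channel

variable {n m : Type} [Fintype n] [Fintype m] [DecidableEq n]

theorem map_eq_sum_single (E : Matrix n n ℂ →ₗ[ℂ] Matrix m m ℂ) (M : Matrix n n ℂ) :
    E M = ∑ i, ∑ i', M i i' • E (Matrix.single i i' 1) := by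
  conv_lhs => rw [Matrix.matrix_eq_sum_single M]
  simp only [map_sum]
  refine Finset.sum_congr rfl fun i _ => Finset.sum_congr rfl fun i' _ => ?_
  rw [← map_smul, Matrix.smul_single, smul_eq_mul, mul_one]

theorem IsChannel.posSemidef_map {E : Matrix n n ℂ →ₗ[ℂ] Matrix m m ℂ} (hE : IsChannel E)
    {M : Matrix n n ℂ} (hM : M.PosSemidef) : (E M).PosSemidef :=
  (hE.completelyPositive Unit _ (hM.submatrix (Prod.snd : Unit × n → n))).submatrix
    (fun i => ((), i))

/-- The Choi matrix of `E` is positive semidefinite, hence Hermitian; compare its blocks. -/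
theorem IsChannel.conjTranspose_map_single {E : Matrix n n ℂ →ₗ[ℂ] Matrix m m ℂ}
    (hE : IsChannel E) (i i' : n) :
    (E (Matrix.single i i' 1))ᴴ = E (Matrix.single i' i 1) := by
  have h := (hE.completelyPositive n _ (Matrix.posSemidef_vecMulVec_self_star
    (fun x : n × n => if x.1 = x.2 then (1 : ℂ) else 0))).1
  have hs : ∀ i i' : n, (Matrix.of fun j j' => Matrix.vecMulVec
      (fun x : n × n => if x.1 = x.2 then (1 : ℂ) else 0)
      (star fun x : n × n => if x.1 = x.2 then (1 : ℂ) else 0) (i, j) (i', j')) =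
      Matrix.single i i' 1 := by
    intro i i'
    ext j j'
    by_cases h1 : i = j <;> by_cases h2 : i' = j' <;>
      simp [Matrix.vecMulVec_apply, h1, h2]
  ext a b
  have := h.apply (i', a) (i, b)
  simp only [ampliation, Matrix.of_apply, hs] at this
  exact this

/-- The image of the observable `P` under the dual of `E`. -/
def dualObs (E : Matrix n n ℂ →ₗ[ℂ] Matrix m m ℂ) (P : Matrix m m ℂ) : Matrix n n ℂ :=
  Matrix.of fun i' i => (E (Matrix.single i i' 1) * P).trace

theorem trace_map_mul (E : Matrix n n ℂ →ₗ[ℂ] Matrix m m ℂ) (M : Matrix n n ℂ)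
    (P : Matrix m m ℂ) : (E M * P).trace = (M * dualObs E P).trace := by
  rw [map_eq_sum_single E M]
  simp only [Finset.sum_mul, Matrix.trace_sum, Matrix.smul_mul, Matrix.trace_smul, smul_eq_mul]
  simp [Matrix.trace, Matrix.mul_apply, dualObs]

theorem IsChannel.dualObs_one [DecidableEq m] {E : Matrix n n ℂ →ₗ[ℂ] Matrix m m ℂ}
    (hE : IsChannel E) : dualObs E 1 = 1 := by
  ext i' i
  rw [dualObs, Matrix.of_apply, mul_one, hE.tracePreserving]
  by_cases h : i' = i
  · subst h; simp
  · simp [h, Matrix.trace_single_eq_of_ne _ _ _ (Ne.symm h)]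

theorem IsChannel.isHermitian_dualObs {E : Matrix n n ℂ →ₗ[ℂ] Matrix m m ℂ} (hE : IsChannel E)
    {P : Matrix m m ℂ} (hP : P.IsHermitian) : (dualObs E P).IsHermitian := by
  ext i i'
  rw [Matrix.conjTranspose_apply, dualObs, Matrix.of_apply, Matrix.of_apply,
    ← Matrix.trace_conjTranspose, Matrix.conjTranspose_mul, hP.eq, hE.conjTranspose_map_single,
    Matrix.trace_mul_comm]

/-- If `±P ≤ 1` for an observable `P`, then its dual image `A` satisfies `A² ≤ 1`. -/
theorem IsChannel.trace_mul_dualObs_sq_le [DecidableEq m] {E : Matrix n n ℂ →ₗ[ℂ] Matrix m m ℂ}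
    (hE : IsChannel E) {P : Matrix m m ℂ} (hP : P.IsHermitian)
    (hP1 : ∀ M : Matrix m m ℂ, M.PosSemidef → 0 ≤ (M * (1 - P)).trace)
    (hP2 : ∀ M : Matrix m m ℂ, M.PosSemidef → 0 ≤ (M * (1 + P)).trace)
    {ρ : Matrix n n ℂ} (hρ : ρ.PosSemidef) :
    (ρ * (dualObs E P * dualObs E P)).trace ≤ ρ.trace := by
  have hA := hE.isHermitian_dualObs hP
  have h1 : ∀ M : Matrix n n ℂ, M.PosSemidef → 0 ≤ (M * (1 - dualObs E P)).trace := by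
    intro M hM
    have := hP1 _ (hE.posSemidef_map hM)
    rwa [mul_sub, Matrix.trace_sub, trace_map_mul, trace_map_mul, ← Matrix.trace_sub, ← mul_sub,
      hE.dualObs_one] at this
  have h2 : ∀ M : Matrix n n ℂ, M.PosSemidef → 0 ≤ (M * (1 + dualObs E P)).trace := by
    intro M hM
    have := hP2 _ (hE.posSemidef_map hM)
    rwa [mul_add, Matrix.trace_add, trace_map_mul, trace_map_mul, ← Matrix.trace_add, ← mul_add,
      hE.dualObs_one] at this
  generalize dualObs E P = A at *
  have hm : (1 - A)ᴴ = 1 - A := (Matrix.isHermitian_one.sub hA).eq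
  have hp : (1 + A)ᴴ = 1 + A := (Matrix.isHermitian_one.add hA).eq
  have k1 := h2 _ (hρ.mul_mul_conjTranspose_same (1 - A))
  have k2 := h1 _ (hρ.mul_mul_conjTranspose_same (1 + A))
  rw [hm, mul_assoc, mul_assoc, Matrix.trace_mul_comm, mul_assoc] at k1
  rw [hp, mul_assoc, mul_assoc, Matrix.trace_mul_comm, mul_assoc] at k2
  have k := add_nonneg k1 k2
  rw [← Matrix.trace_add, ← mul_add] at k
  -- This writes `2(1 - A²)` as a sum of conjugates of `1 ± A`, each positive.
  have e : (1 - A) * (1 + A) * (1 - A) + (1 + A) * (1 - A) * (1 + A) =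
      (2 : ℂ) • (1 - A * A) := by
    rw [two_smul]; noncomm_ring
  rw [e, Matrix.mul_smul, Matrix.trace_smul, mul_sub, mul_one, Matrix.trace_sub, smul_eq_mul] at k
  have h := mul_nonneg (show (0 : ℂ) ≤ ((1 / 2 : ℝ) : ℂ) from
    Complex.zero_le_real.2 (by norm_num)) k
  rw [← mul_assoc, show ((1 / 2 : ℝ) : ℂ) * 2 = 1 by push_cast; norm_num, one_mul] at h
  exact sub_nonneg.1 h

theorem pauliZ_isHermitian : pauliZ.IsHermitian := by
  ext i j
  fin_cases i <;> fin_cases j <;> simp [pauliZ]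

theorem trace_mul_one_sub_pauliZ_nonneg {M : Matrix (Fin 2) (Fin 2) ℂ} (hM : M.PosSemidef) :
    0 ≤ (M * (1 - pauliZ)).trace := by
  have := hM.diag_nonneg (i := 1)
  have e : (M * (1 - pauliZ)).trace = M 1 1 + M 1 1 := by
    simp [Matrix.trace, Matrix.mul_apply, pauliZ, Fin.sum_univ_two]
    ring
  rw [e]
  exact add_nonneg this this

theorem trace_mul_one_add_pauliZ_nonneg {M : Matrix (Fin 2) (Fin 2) ℂ} (hM : M.PosSemidef) :
    0 ≤ (M * (1 + pauliZ)).trace := by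
  have := hM.diag_nonneg (i := 0)
  have e : (M * (1 + pauliZ)).trace = M 0 0 + M 0 0 := by
    simp [Matrix.trace, Matrix.mul_apply, pauliZ, Fin.sum_univ_two]
    ring
  rw [e]
  exact add_nonneg this this

end Channel

/-! ### Tensor products of channels -/

section TensorMap

variable {n₁ n₂ n₃ m₁ m₂ m₃ : Type} [Fintype n₁] [Fintype n₂] [Fintype n₃] [DecidableEq n₁]
  [DecidableEq n₂] [DecidableEq n₃] [Fintype m₁] [Fintype m₂] [Fintype m₃]
  {E : Matrix n₁ n₁ ℂ →ₗ[ℂ] Matrix m₁ m₁ ℂ} {F : Matrix n₂ n₂ ℂ →ₗ[ℂ] Matrix m₂ m₂ ℂ}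
  {G : Matrix n₃ n₃ ℂ →ₗ[ℂ] Matrix m₃ m₃ ℂ}

theorem trace_tensorMap_mul (M : Matrix (n₁ × n₂ × n₃) (n₁ × n₂ × n₃) ℂ) (P : Matrix m₁ m₁ ℂ)
    (Q : Matrix m₂ m₂ ℂ) (R : Matrix m₃ m₃ ℂ) :
    (tensorMap E F G M * (P ⊗ₖ (Q ⊗ₖ R))).trace =
      (M * (dualObs E P ⊗ₖ (dualObs F Q ⊗ₖ dualObs G R))).trace := by
  simp only [tensorMap, Finset.sum_mul, Matrix.trace_sum, Matrix.smul_mul, Matrix.trace_smul,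
    ← Matrix.mul_kronecker_mul, Matrix.trace_kronecker, smul_eq_mul]
  simp only [Matrix.trace, Matrix.diag, Matrix.mul_apply, Fintype.sum_prod_type,
    Matrix.kroneckerMap_apply, dualObs, Matrix.of_apply]
  refine Finset.sum_congr rfl fun i _ => ?_
  rw [Finset.sum_comm]
  refine Finset.sum_congr rfl fun j _ => ?_
  rw [Finset.sum_comm (s := (Finset.univ : Finset n₃))]
  refine Finset.sum_congr rfl fun i' _ => ?_
  rw [Finset.sum_comm]

/-- Apply `G`, `F`, `E` one at a time, each amplified by the other two systems, regrouping the
factors in between. -/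
theorem posSemidef_tensorMap (hE : IsChannel E) (hF : IsChannel F) (hG : IsChannel G)
    {M : Matrix (n₁ × n₂ × n₃) (n₁ × n₂ × n₃) ℂ} (hM : M.PosSemidef) :
    (tensorMap E F G M).PosSemidef := by
  have h1 := hG.completelyPositive (n₁ × n₂) _ (hM.submatrix (Equiv.prodAssoc n₁ n₂ n₃))
  have h2 := hF.completelyPositive (n₁ × m₃) _
    (h1.submatrix fun x : (n₁ × m₃) × n₂ => ((x.1.1, x.2), x.1.2))
  have h3 := hE.completelyPositive (m₂ × m₃) _
    (h2.submatrix fun x : (m₂ × m₃) × n₁ => ((x.2, x.1.2), x.1.1))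
  convert h3.submatrix (fun x : m₁ × m₂ × m₃ => (x.2, x.1)) using 1
  ext ⟨a, b, c⟩ ⟨a', b', c'⟩
  simp only [ampliation, Matrix.submatrix_apply, Matrix.of_apply]
  rw [map_eq_sum_single E]
  simp only [Matrix.of_apply, Matrix.sum_apply, Matrix.smul_apply, smul_eq_mul, tensorMap,
    Matrix.kroneckerMap_apply]
  refine Finset.sum_congr rfl fun i _ => Finset.sum_congr rfl fun i' _ => ?_
  rw [map_eq_sum_single F]
  simp only [Matrix.of_apply, Matrix.sum_apply, Matrix.smul_apply, smul_eq_mul, Finset.sum_mul]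
  refine Finset.sum_congr rfl fun j _ => Finset.sum_congr rfl fun j' _ => ?_
  rw [map_eq_sum_single G]
  simp only [Matrix.of_apply, Matrix.sum_apply, Matrix.smul_apply, smul_eq_mul, Finset.sum_mul,
    Equiv.prodAssoc_apply]
  refine Finset.sum_congr rfl fun k _ => Finset.sum_congr rfl fun k' _ => ?_
  ring

end TensorMap

/-! ### Two-party correlations of the source state -/

section Source

variable {aB aC bA bC cA cB : Type} [Fintype aB] [Fintype aC] [Fintype bA] [Fintype bC]
  [Fintype cA] [Fintype cB] [DecidableEq aB] [DecidableEq aC] [DecidableEq bA] [DecidableEq bC]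
  [DecidableEq cA] [DecidableEq cB]
  (ρa : Matrix (aB × aC) (aB × aC) ℂ) (ρb : Matrix (bA × bC) (bA × bC) ℂ)
  (ρc : Matrix (cA × cB) (cA × cB) ℂ)

theorem posSemidef_sourceState (ha : ρa.PosSemidef) (hb : ρb.PosSemidef) (hc : ρc.PosSemidef) :
    (sourceState ρa ρb ρc).PosSemidef :=
  ((ha.kronecker hb).kronecker hc).submatrix
    (fun x : (cA × bA) × (aB × cB) × (bC × aC) =>
      (((x.2.1.1, x.2.2.2), (x.1.2, x.2.2.1)), (x.1.1, x.2.1.2)))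

theorem condLeft_marginalLeft_apply {m n l : Type} [Fintype m] [Fintype n] [Fintype l]
    (ρ : Matrix (n × l) (n × l) ℂ) (A : Matrix (m × n) (m × n) ℂ) (i i' : m) :
    condLeft (marginalLeft ρ) A i i' =
      ∑ s : n × n × l, ρ (s.1, s.2.2) (s.2.1, s.2.2) * A (i, s.2.1) (i', s.1) := by
  simp only [condLeft, marginalLeft, Matrix.of_apply, Fintype.sum_prod_type, Finset.sum_mul]

theorem condLeft_marginalRight_apply {m n l : Type} [Fintype m] [Fintype n] [Fintype l]
    (ρ : Matrix (l × n) (l × n) ℂ) (A : Matrix (m × n) (m × n) ℂ) (i i' : m) :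
    condLeft (marginalRight ρ) A i i' =
      ∑ s : n × n × l, ρ (s.2.2, s.1) (s.2.2, s.2.1) * A (i, s.2.1) (i', s.1) := by
  simp only [condLeft, marginalRight, Matrix.of_apply, Fintype.sum_prod_type, Finset.sum_mul]

theorem condRight_marginalLeft_apply {m n l : Type} [Fintype m] [Fintype n] [Fintype l]
    (ρ : Matrix (m × l) (m × l) ℂ) (A : Matrix (m × n) (m × n) ℂ) (j j' : n) :
    condRight (marginalLeft ρ) A j j' =
      ∑ s : m × m × l, ρ (s.1, s.2.2) (s.2.1, s.2.2) * A (s.2.1, j) (s.1, j') := by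
  simp only [condRight, marginalLeft, Matrix.of_apply, Fintype.sum_prod_type, Finset.sum_mul]

theorem condRight_marginalRight_apply {m n l : Type} [Fintype m] [Fintype n] [Fintype l]
    (ρ : Matrix (l × m) (l × m) ℂ) (A : Matrix (m × n) (m × n) ℂ) (j j' : n) :
    condRight (marginalRight ρ) A j j' =
      ∑ s : m × m × l, ρ (s.2.2, s.1) (s.2.2, s.2.1) * A (s.2.1, j) (s.1, j') := by
  simp only [condRight, marginalRight, Matrix.of_apply, Fintype.sum_prod_type, Finset.sum_mul]

/-- Flattens the trace to a single sum over a product type, so that the correlation formulas below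
reduce to a bijection of indices. -/
theorem trace_mul_kronecker_sum {m n S T : Type} [Fintype m] [Fintype n] [Fintype S] [Fintype T]
    (ρ : Matrix (m × n) (m × n) ℂ) (X : Matrix m m ℂ) (Y : Matrix n n ℂ)
    (f : m → m → S → ℂ) (g : n → n → T → ℂ) (hX : ∀ i i', X i i' = ∑ s, f i i' s)
    (hY : ∀ j j', Y j j' = ∑ t, g j j' t) :
    (ρ * (X ⊗ₖ Y)).trace =
      ∑ z : ((m × n) × (m × n)) × (S × T),
        ρ z.1.1 z.1.2 * (f z.1.2.1 z.1.1.1 z.2.1 * g z.1.2.2 z.1.1.2 z.2.2) := by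
  simp only [Matrix.trace, Matrix.diag, Matrix.mul_apply, Matrix.kroneckerMap_apply, hX, hY,
    Finset.sum_mul_sum]
  simp only [Fintype.sum_prod_type (α₂ := S × T), Fintype.sum_prod_type (α₁ := S),
    Fintype.sum_prod_type (α₁ := m × n), Finset.mul_sum]

/-- With the third party traced out, the two sources it shares enter only through marginals, and
averaging over these turns `A` and `B` into conditional expectations on the common source. -/
theorem trace_sourceState_mul_AB (A : Matrix (cA × bA) (cA × bA) ℂ)
    (B : Matrix (aB × cB) (aB × cB) ℂ) :
    (sourceState ρa ρb ρc * (A ⊗ₖ (B ⊗ₖ 1))).trace =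
      (ρc * (condLeft (marginalLeft ρb) A ⊗ₖ condRight (marginalLeft ρa) B)).trace := by
  rw [trace_mul_kronecker_sum _ _ _ _ _ (condLeft_marginalLeft_apply ρb A)
    (condRight_marginalLeft_apply ρa B)]
  have h : (sourceState ρa ρb ρc * (A ⊗ₖ (B ⊗ₖ 1))).trace =
      ∑ z : ((cA × bA) × (aB × cB) × (bC × aC)) × ((cA × bA) × (aB × cB)),
        sourceState ρa ρb ρc z.1 (z.2.1, z.2.2, z.1.2.2) * (A z.2.1 z.1.1 * B z.2.2 z.1.2.1) := by
    simp only [Matrix.trace, Matrix.diag, Matrix.mul_apply, Matrix.kroneckerMap_apply,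
      Matrix.one_apply, Fintype.sum_prod_type (α₁ := cA × bA),
      Fintype.sum_prod_type (α₁ := (cA × bA) × (aB × cB) × (bC × aC)),
      Fintype.sum_prod_type (α₁ := aB × cB), mul_ite, mul_one, mul_zero, Finset.sum_ite_eq',
      Finset.mem_univ, if_true]
  rw [h]
  refine Fintype.sum_equiv
    { toFun := fun ((((c, b), (a, c'), (k, l)), ((d, e), (f, d')))) =>
        (((c, c'), (d, d')), ((b, e, k), (a, f, l)))
      invFun := fun (((c, c'), (d, d')), ((b, e, k), (a, f, l))) =>
        (((c, b), (a, c'), (k, l)), ((d, e), (f, d')))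
      left_inv := fun _ => rfl
      right_inv := fun _ => rfl } _ _ fun _ => ?_
  simp only [sourceState, Matrix.of_apply, Equiv.coe_fn_mk]
  ring

theorem trace_sourceState_mul_AC (A : Matrix (cA × bA) (cA × bA) ℂ)
    (C : Matrix (bC × aC) (bC × aC) ℂ) :
    (sourceState ρa ρb ρc * (A ⊗ₖ (1 ⊗ₖ C))).trace =
      (ρb * (condRight (marginalLeft ρc) A ⊗ₖ condLeft (marginalRight ρa) C)).trace := by
  rw [trace_mul_kronecker_sum _ _ _ _ _ (condRight_marginalLeft_apply ρc A)
    (condLeft_marginalRight_apply ρa C)]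
  have h : (sourceState ρa ρb ρc * (A ⊗ₖ (1 ⊗ₖ C))).trace =
      ∑ z : ((cA × bA) × (aB × cB) × (bC × aC)) × ((cA × bA) × (bC × aC)),
        sourceState ρa ρb ρc z.1 (z.2.1, z.1.2.1, z.2.2) * (A z.2.1 z.1.1 * C z.2.2 z.1.2.2) := by
    simp only [Matrix.trace, Matrix.diag, Matrix.mul_apply, Matrix.kroneckerMap_apply,
      Matrix.one_apply, Fintype.sum_prod_type (α₁ := cA × bA),
      Fintype.sum_prod_type (α₁ := (cA × bA) × (aB × cB) × (bC × aC)),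
      Fintype.sum_prod_type_right (α₁ := aB × cB), mul_ite, ite_mul, one_mul, zero_mul, mul_zero,
      Finset.sum_ite_eq', Finset.mem_univ, if_true]
  rw [h]
  refine Fintype.sum_equiv
    { toFun := fun ((((c, b), (a, c'), (k, l)), ((d, e), (g, f)))) =>
        (((b, k), (e, g)), ((c, d, c'), (l, f, a)))
      invFun := fun (((b, k), (e, g)), ((c, d, c'), (l, f, a))) =>
        (((c, b), (a, c'), (k, l)), ((d, e), (g, f)))
      left_inv := fun _ => rfl
      right_inv := fun _ => rfl } _ _ fun _ => ?_
  simp only [sourceState, Matrix.of_apply, Equiv.coe_fn_mk]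
  ring

theorem trace_sourceState_mul_BC (B : Matrix (aB × cB) (aB × cB) ℂ)
    (C : Matrix (bC × aC) (bC × aC) ℂ) :
    (sourceState ρa ρb ρc * (1 ⊗ₖ (B ⊗ₖ C))).trace =
      (ρa * (condLeft (marginalRight ρc) B ⊗ₖ condRight (marginalRight ρb) C)).trace := by
  rw [trace_mul_kronecker_sum _ _ _ _ _ (condLeft_marginalRight_apply ρc B)
    (condRight_marginalRight_apply ρb C)]
  have h : (sourceState ρa ρb ρc * (1 ⊗ₖ (B ⊗ₖ C))).trace =
      ∑ z : ((cA × bA) × (aB × cB) × (bC × aC)) × ((aB × cB) × (bC × aC)),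
        sourceState ρa ρb ρc z.1 (z.1.1, z.2.1, z.2.2) * (B z.2.1 z.1.2.1 * C z.2.2 z.1.2.2) := by
    simp only [Matrix.trace, Matrix.diag, Matrix.mul_apply, Matrix.kroneckerMap_apply,
      Matrix.one_apply, Fintype.sum_prod_type_right (α₁ := cA × bA),
      Fintype.sum_prod_type (α₁ := (cA × bA) × (aB × cB) × (bC × aC)),
      Fintype.sum_prod_type (α₁ := aB × cB), mul_ite, ite_mul, one_mul, zero_mul, mul_zero,
      Finset.sum_ite_eq', Finset.mem_univ, if_true]
  rw [h]
  refine Fintype.sum_equiv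
    { toFun := fun ((((c, b), (a, c'), (k, l)), ((f, d), (g, h)))) =>
        (((a, l), (f, h)), ((c', d, c), (k, g, b)))
      invFun := fun (((a, l), (f, h)), ((c', d, c), (k, g, b))) =>
        (((c, b), (a, c'), (k, l)), ((f, d), (g, h)))
      left_inv := fun _ => rfl
      right_inv := fun _ => rfl } _ _ fun _ => ?_
  simp only [sourceState, Matrix.of_apply, Equiv.coe_fn_mk]
  ring

end Source

/-! ### The gap of a triangle state without shared randomness -/

section Triangle

variable {aB aC bA bC cA cB : Type} [Fintype aB] [Fintype aC] [Fintype bA] [Fintype bC]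
  [Fintype cA] [Fintype cB] [DecidableEq aB] [DecidableEq aC] [DecidableEq bA] [DecidableEq bC]
  [DecidableEq cA] [DecidableEq cB]
  {ρa : Matrix (aB × aC) (aB × aC) ℂ} {ρb : Matrix (bA × bC) (bA × bC) ℂ}
  {ρc : Matrix (cA × cB) (cA × cB) ℂ}
  {EA : Matrix (cA × bA) (cA × bA) ℂ →ₗ[ℂ] Matrix (Fin 2) (Fin 2) ℂ}
  {EB : Matrix (aB × cB) (aB × cB) ℂ →ₗ[ℂ] Matrix (Fin 2) (Fin 2) ℂ}
  {EC : Matrix (bC × aC) (bC × aC) ℂ →ₗ[ℂ] Matrix (Fin 2) (Fin 2) ℂ}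

theorem isState_sourceState (ha : IsState ρa) (hb : IsState ρb) (hc : IsState ρc) :
    IsState (sourceState ρa ρb ρc) := by
  refine ⟨posSemidef_sourceState ρa ρb ρc ha.1 hb.1 hc.1, ?_⟩
  have h := trace_sourceState_mul_AB ρa ρb ρc 1 1
  simpa only [condLeft_one, condRight_one, (isState_marginalLeft ha).2, (isState_marginalLeft hb).2,
    one_smul, Matrix.one_kronecker_one, mul_one, hc.2] using h

theorem isState_tensorMap {n₁ n₂ n₃ : Type} [Fintype n₁] [Fintype n₂] [Fintype n₃]
    [DecidableEq n₁] [DecidableEq n₂] [DecidableEq n₃] {m₁ m₂ m₃ : Type} [Fintype m₁] [Fintype m₂]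
    [Fintype m₃] [DecidableEq m₁] [DecidableEq m₂] [DecidableEq m₃]
    {E : Matrix n₁ n₁ ℂ →ₗ[ℂ] Matrix m₁ m₁ ℂ} {F : Matrix n₂ n₂ ℂ →ₗ[ℂ] Matrix m₂ m₂ ℂ}
    {G : Matrix n₃ n₃ ℂ →ₗ[ℂ] Matrix m₃ m₃ ℂ} (hE : IsChannel E) (hF : IsChannel F)
    (hG : IsChannel G) {M : Matrix (n₁ × n₂ × n₃) (n₁ × n₂ × n₃) ℂ} (hM : IsState M) :
    IsState (tensorMap E F G M) := by
  refine ⟨posSemidef_tensorMap hE hF hG hM.1, ?_⟩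
  have h := trace_tensorMap_mul (E := E) (F := F) (G := G) M 1 1 1
  simpa only [hE.dualObs_one, hF.dualObs_one, hG.dualObs_one, Matrix.one_kronecker_one, mul_one,
    hM.2] using h

theorem sum_condVariance_dualObs_le {m n : Type} [Fintype m] [Fintype n] [DecidableEq m]
    [DecidableEq n] {E : Matrix (m × n) (m × n) ℂ →ₗ[ℂ] Matrix (Fin 2) (Fin 2) ℂ}
    (hE : IsChannel E) {γ : Matrix m m ℂ} {ω : Matrix n n ℂ} (hγ : IsState γ) (hω : IsState ω)
    {e : ℝ} (he : ((γ ⊗ₖ ω) * dualObs E pauliZ).trace = e) :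
    (γ * (condLeft ω (dualObs E pauliZ) * condLeft ω (dualObs E pauliZ))).trace.re +
        (ω * (condRight γ (dualObs E pauliZ) * condRight γ (dualObs E pauliZ))).trace.re ≤
      1 + e ^ 2 := by
  have h1 := sum_condVariance_le hγ hω (hE.isHermitian_dualObs pauliZ_isHermitian)
  have h2 := hE.trace_mul_dualObs_sq_le pauliZ_isHermitian
    (fun _ => trace_mul_one_sub_pauliZ_nonneg) (fun _ => trace_mul_one_add_pauliZ_nonneg)
    (hγ.1.kronecker hω.1)
  rw [Matrix.trace_kronecker, hγ.2, hω.2, one_mul] at h2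
  have h3 := (Complex.le_def.1 h2).1
  rw [he, Complex.ofReal_re] at h1
  rw [Complex.one_re] at h3
  linarith

theorem covarianceGap_tensorMap_nonneg (ha : IsState ρa) (hb : IsState ρb) (hc : IsState ρc)
    (hEA : IsChannel EA) (hEB : IsChannel EB) (hEC : IsChannel EC) :
    0 ≤ covarianceGap (tensorMap EA EB EC (sourceState ρa ρb ρc)) := by
  have haL := isState_marginalLeft ha
  have haR := isState_marginalRight ha
  have hbL := isState_marginalLeft hb
  have hbR := isState_marginalRight hb
  have hcL := isState_marginalLeft hc
  have hcR := isState_marginalRight hc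
  have hA := hEA.isHermitian_dualObs pauliZ_isHermitian
  have hB := hEB.isHermitian_dualObs pauliZ_isHermitian
  have hC := hEC.isHermitian_dualObs pauliZ_isHermitian
  obtain ⟨a, hea⟩ : ∃ a : ℝ, ((marginalLeft ρc ⊗ₖ marginalLeft ρb) * dualObs EA pauliZ).trace = a :=
    ⟨_, (ofReal_re_trace_mul (hcL.1.kronecker hbL.1).1 hA).symm⟩
  obtain ⟨b, heb⟩ :
      ∃ b : ℝ, ((marginalLeft ρa ⊗ₖ marginalRight ρc) * dualObs EB pauliZ).trace = b :=
    ⟨_, (ofReal_re_trace_mul (haL.1.kronecker hcR.1).1 hB).symm⟩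
  obtain ⟨c, hec⟩ :
      ∃ c : ℝ, ((marginalRight ρb ⊗ₖ marginalRight ρa) * dualObs EC pauliZ).trace = c :=
    ⟨_, (ofReal_re_trace_mul (hbR.1.kronecker haR.1).1 hC).symm⟩
  have vA := sum_condVariance_dualObs_le hEA hcL hbL hea
  have vB := sum_condVariance_dualObs_le hEB haL hcR heb
  have vC := sum_condVariance_dualObs_le hEC hbR haR hec
  -- Each mean is needed twice, as the mean of the conditional expectation on either half.
  have hea' := hea
  have heb' := heb
  have hec' := hec
  rw [trace_kronecker_mul_eq_left] at hea heb hec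
  rw [trace_kronecker_mul_eq_right] at hea' heb' hec'
  have cAB := two_mul_covariance_le hc (isHermitian_condLeft hbL.1.1 hA)
    (isHermitian_condRight haL.1.1 hB) hea heb'
  have cAC := two_mul_covariance_le hb (isHermitian_condRight hcL.1.1 hA)
    (isHermitian_condLeft haR.1.1 hC) hea' hec
  have cBC := two_mul_covariance_le ha (isHermitian_condLeft hcR.1.1 hB)
    (isHermitian_condRight hbR.1.1 hC) heb hec'
  have z01 : zObs 0 * zObs 1 = pauliZ ⊗ₖ (pauliZ ⊗ₖ 1) := by
    simp [zObs, ← Matrix.mul_kronecker_mul]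
  have z02 : zObs 0 * zObs 2 = pauliZ ⊗ₖ (1 ⊗ₖ pauliZ) := by
    simp [zObs, ← Matrix.mul_kronecker_mul]
  have z12 : zObs 1 * zObs 2 = 1 ⊗ₖ (pauliZ ⊗ₖ pauliZ) := by
    simp [zObs, ← Matrix.mul_kronecker_mul]
  have e0 : E₁ (tensorMap EA EB EC (sourceState ρa ρb ρc)) 0 = a := by
    change expect _ (pauliZ ⊗ₖ (1 ⊗ₖ 1)) = a
    rw [expect, trace_tensorMap_mul, hEB.dualObs_one, hEC.dualObs_one, trace_sourceState_mul_AB,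
      condRight_one, haL.2, one_smul, trace_mul_kronecker_one, hea, Complex.ofReal_re]
  have e1 : E₁ (tensorMap EA EB EC (sourceState ρa ρb ρc)) 1 = b := by
    change expect _ (1 ⊗ₖ (pauliZ ⊗ₖ 1)) = b
    rw [expect, trace_tensorMap_mul, hEA.dualObs_one, hEC.dualObs_one, trace_sourceState_mul_AB,
      condLeft_one, hbL.2, one_smul, trace_mul_one_kronecker, heb', Complex.ofReal_re]
  have e2 : E₁ (tensorMap EA EB EC (sourceState ρa ρb ρc)) 2 = c := by
    change expect _ (1 ⊗ₖ (1 ⊗ₖ pauliZ)) = c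
    rw [expect, trace_tensorMap_mul, hEA.dualObs_one, hEB.dualObs_one, trace_sourceState_mul_AC,
      condRight_one, hcL.2, one_smul, trace_mul_one_kronecker, hec, Complex.ofReal_re]
  rw [covarianceGap, e0, e1, e2, E₂, E₂, E₂, z01, z02, z12, expect, expect, expect,
    trace_tensorMap_mul, trace_tensorMap_mul, trace_tensorMap_mul, hEA.dualObs_one, hEB.dualObs_one,
    hEC.dualObs_one, trace_sourceState_mul_AB, trace_sourceState_mul_AC, trace_sourceState_mul_BC]
  linarith

end Triangle

/-! ### Shared randomness and the final bound -/

theorem hasSum_ghzFidelity {L : Type} {f : L → Matrix Qubits3 Qubits3 ℂ}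
    {ρ : Matrix Qubits3 Qubits3 ℂ} (h : HasSum f ρ) :
    HasSum (fun l => ghzFidelity (f l)) (ghzFidelity ρ) := by
  have he : ∀ x y, HasSum (fun l => (f l x y).re) (ρ x y).re := fun x y =>
    Complex.hasSum_re (Pi.hasSum.1 (Pi.hasSum.1 h x) y)
  simp only [ghzFidelity_eq]
  exact ((((he _ _).add (he _ _)).add (he _ _)).add (he _ _)).div_const 2

theorem ghzFidelity_smul (p : ℝ) (ρ : Matrix Qubits3 Qubits3 ℂ) :
    ghzFidelity ((p : ℂ) • ρ) = p * ghzFidelity ρ := by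
  simp only [ghzFidelity_eq, Matrix.smul_apply, smul_eq_mul, Complex.re_ofReal_mul]
  ring

theorem IsTriangleState.ghzFidelity_le {ρ : Matrix Qubits3 Qubits3 ℂ} (hρ : IsTriangleState ρ) :
    ghzFidelity ρ ≤ 1 / Real.sqrt 2 := by
  obtain ⟨aB, aC, bA, bC, cA, cB, ρa, ρb, ρc, L, p, EA, EB, EC, ha, hb, hc, hp, hp1, hE, hsum⟩ := hρ
  have h1 := hasSum_ghzFidelity hsum
  have h2 := hp1.mul_right (1 / Real.sqrt 2)
  rw [one_mul] at h2
  refine hasSum_le (fun l => ?_) h1 h2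
  rw [ghzFidelity_smul]
  obtain ⟨hA, hB, hC⟩ := hE l
  exact mul_le_mul_of_nonneg_left (ghzFidelity_le_of_covarianceGap_nonneg
    (isState_tensorMap hA hB hC (isState_sourceState ha hb hc))
    (covarianceGap_tensorMap_nonneg ha hb hc hA hB hC)) (hp l)

end TriangleNet

theorem mainTheorem8 :
    (∀ ρ : Matrix TriangleNet.Qubits3 TriangleNet.Qubits3 ℂ,
      TriangleNet.IsTriangleState ρ → TriangleNet.ghzFidelity ρ ≤ 1 / Real.sqrt 2) ∧
    (∀ (F : ℝ) (σ : Matrix TriangleNet.Qubits3 TriangleNet.Qubits3 ℂ),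
      0 ≤ F → F ≤ 1 → TriangleNet.IsState σ →
      TriangleNet.GisinInequality (TriangleNet.ghzMix F σ) → F ≤ 1 / Real.sqrt 2) ∧
    (∀ (F : ℝ) (σ : Matrix TriangleNet.Qubits3 TriangleNet.Qubits3 ℂ),
      0 ≤ F → F ≤ 1 → TriangleNet.IsState σ →
      (TriangleNet.comparisonMatrix
        (TriangleNet.covMatrix (TriangleNet.ghzMix F σ))).PosSemidef → F ≤ 3 / 4) :=
  ⟨fun _ hρ => hρ.ghzFidelity_le,
    fun _ _ hF0 hF1 hσ h => TriangleNet.le_inv_sqrt_two_of_gisinInequality hF0 hF1 hσ h,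
    fun _ _ _ hF1 hσ h => TriangleNet.le_three_quarters_of_posSemidef hF1 hσ h⟩
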